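/- Let $S$ be a monoid with identity $1$. A right $S$-act is a set $X$ with a map $X\times S\to X$, $(x,s)\mapsto xs$, such that $x1=x$ and $x(st)=(xs)t$; an $S$-map is a map $f$ with $f(xs)=f(x)s$. A right $S$-act $X$ satisfies condition $(P)$ if whenever $au=a'u'$ with $a,a'\in X$, $u,u'\in S$, there are $b\in X$, $s,s'\in S$ with $a=bs$, $a'=bs'$ and $su=s'u'$; it satisfies condition $(E)$ if whenever $au=au'$ with $a\in X$, $u,u'\in S$, there are $b\in X$, $s\in S$ with $a=bs$ and $su=su'$. Let $\mathcal{CP}_S$ be the class of right $S$-acts satisfying $(P)$, and $\mathcal{SF}_S$ the class of strongly flat right $S$-acts, i.e. those satisfying both $(P)$ and $(E)$. A right $S$-act $X$ is locally cyclic if for all $x,y\in X$ there are $z\in X$, $s,t\in S$ with $x=zs$, $y=zt$. For a class $\mathcal X$ of right $S$-acts, an $\mathcal X$-precover of a right $S$-act $A$ is an $S$-map $g:P\to A$ with $P\in\mathcal X$ such that every $S$-map $g':P'\to A$ with $P'\in\mathcal X$ is of the form $g'=gf$ for some $S$-map $f:P'\to P$. It is an $\mathcal X$-cover if moreover every $S$-map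 $f:P\to P$ with $gf=g$ is an isomorphism. Let $\mathcal M_{\mathcal{SF}}$ (respectively $\mathcal M_{\mathcal{CP}}$) be the class of monoids $T$ for which there is a cardinal $\kappa$ with $|X|<\kappa$ for all locally cyclic right $T$-acts $X$ in $\mathcal{SF}_T$ (respectively in $\mathcal{CP}_T$). **Theorem.** 1. Each of the classes $\mathcal M_{\mathcal{SF}}$ and $\mathcal M_{\mathcal{CP}}$ is closed under taking submonoids. 2. If $S\in\mathcal M_{\mathcal{SF}}$, then every right $S$-act has an $\mathcal{SF}$-cover. If $S\in\mathcal M_{\mathcal{CP}}$, then every right $S$-act has an $\mathcal{SF}$-cover and a $\mathcal{CP}$-cover. 3. If $S$ is any submonoid of the bicyclic monoid, i.e. of $\mathbb N\times\mathbb N$ ($0\in\mathbb N$) with $(p,q)(s,t)=(p-q+\max(q,s),\,t-s+\max(q,s))$ and identity $(0,0)$, then every right $S$-act has an $\mathcal{SF}$-cover and a $\mathcal{CP}$-cover. -/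

import Mathlib

universe u v w

open scoped RightActions

namespace MonoidAct

/-! A right `S`-act is a type `X` with an instance `MulAction Sᵐᵒᵖ X`; the element `x s` is
written `x <• s`, that is `MulOpposite.op s • x`. An `S`-map is an `X →[Sᵐᵒᵖ] Y`. -/

section Acts

variable (S : Type u) [Monoid S]

/-- A class of right `S`-acts. -/
abbrev ActClass : Type (max u (w + 1)) :=
  ∀ (X : Type w) [MulAction Sᵐᵒᵖ X], Prop

/-- Condition `(P)`. -/
def ConditionP (X : Type w) [MulAction Sᵐᵒᵖ X] : Prop :=
  ∀ (a a' : X) (t t' : S), a <• t = a' <• t' →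
    ∃ (b : X) (s s' : S), a = b <• s ∧ a' = b <• s' ∧ s * t = s' * t'

/-- Condition `(E)`. -/
def ConditionE (X : Type w) [MulAction Sᵐᵒᵖ X] : Prop :=
  ∀ (a : X) (t t' : S), a <• t = a <• t' →
    ∃ (b : X) (s : S), a = b <• s ∧ s * t = s * t'

/-- Strongly flat acts: those satisfying both interpolation conditions `(P)` and `(E)`. -/
def StronglyFlat (X : Type w) [MulAction Sᵐᵒᵖ X] : Prop :=
  ConditionP S X ∧ ConditionE S X

/-- Locally cyclic acts: any two elements lie in a common cyclic subact. -/
def LocallyCyclic (X : Type w) [MulAction Sᵐᵒᵖ X] : Prop :=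
  ∀ x y : X, ∃ (z : X) (s t : S), x = z <• s ∧ y = z <• t

/-- There is a cardinal strictly above the cardinalities of all locally cyclic right `S`-acts
in the class `𝒳`. -/
def LocallyCyclicBounded (𝒳 : ActClass.{u, w} S) : Prop :=
  ∃ κ : Cardinal.{w}, ∀ (X : Type w) [MulAction Sᵐᵒᵖ X],
    𝒳 X → LocallyCyclic S X → Cardinal.mk X < κ

/-- The monoids `S` whose locally cyclic strongly flat right acts are bounded in size. -/
def ClassMSF : Prop := LocallyCyclicBounded.{u, w} S (fun X _ => StronglyFlat S X)

/-- The monoids `S` whose locally cyclic right acts with condition `(P)` are bounded in size. -/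
def ClassMCP : Prop := LocallyCyclicBounded.{u, w} S (fun X _ => ConditionP S X)

variable {S}

/-- `g : P → A` is an `𝒳`-precover of `A`: `P` is in `𝒳` and every `S`-map to `A` from an act
in `𝒳` factors through `g`. -/
def IsPrecover (𝒳 : ActClass.{u, w} S) {P A : Type w} [MulAction Sᵐᵒᵖ P] [MulAction Sᵐᵒᵖ A]
    (g : P →[Sᵐᵒᵖ] A) : Prop :=
  𝒳 P ∧ ∀ (P' : Type w) [MulAction Sᵐᵒᵖ P'], 𝒳 P' → ∀ g' : P' →[Sᵐᵒᵖ] A,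
    ∃ f : P' →[Sᵐᵒᵖ] P, g.comp f = g'

/-- `f` is an isomorphism of `S`-acts. -/
def IsActIso {X Y : Type w} [MulAction Sᵐᵒᵖ X] [MulAction Sᵐᵒᵖ Y] (f : X →[Sᵐᵒᵖ] Y) : Prop :=
  ∃ h : Y →[Sᵐᵒᵖ] X, h.comp f = MulActionHom.id Sᵐᵒᵖ ∧ f.comp h = MulActionHom.id Sᵐᵒᵖ

/-- `g : P → A` is an `𝒳`-cover of `A`: a precover such that every endomorphism `f` of `P` with
`g f = g` is an isomorphism. -/
def IsCover (𝒳 : ActClass.{u, w} S) {P A : Type w} [MulAction Sᵐᵒᵖ P] [MulAction Sᵐᵒᵖ A]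
    (g : P →[Sᵐᵒᵖ] A) : Prop :=
  IsPrecover 𝒳 g ∧ ∀ f : P →[Sᵐᵒᵖ] P, g.comp f = g → IsActIso f

/-- The act `A` has an `𝒳`-cover. -/
def HasCover (𝒳 : ActClass.{u, w} S) (A : Type w) [MulAction Sᵐᵒᵖ A] : Prop :=
  ∃ (P : Type w) (_ : MulAction Sᵐᵒᵖ P) (g : P →[Sᵐᵒᵖ] A), IsCover 𝒳 g

variable (S)

/-- The act `A` has an `SF`-cover. -/
def HasSFCover (A : Type w) [MulAction Sᵐᵒᵖ A] : Prop :=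
  HasCover (S := S) (fun X _ => StronglyFlat S X) A

/-- The act `A` has a `CP`-cover. -/
def HasCPCover (A : Type w) [MulAction Sᵐᵒᵖ A] : Prop :=
  HasCover (S := S) (fun X _ => ConditionP S X) A

end Acts

/-- The elements of the bicyclic monoid: pairs of natural numbers. -/
@[ext]
structure Bicyclic : Type where
  /-- first coordinate -/
  fst : ℕ
  /-- second coordinate -/
  snd : ℕ

/-- `(p, q) (s, t) = (p - q + max q s, t - s + max q s)`; the truncated differences
`max q s - q` and `max q s - s` below are genuine ones. -/
instance : Mul Bicyclic :=
  ⟨fun x y => ⟨x.fst + (max x.snd y.fst - x.snd), y.snd + (max x.snd y.fst - y.fst)⟩⟩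

instance : One Bicyclic := ⟨⟨0, 0⟩⟩

theorem Bicyclic.mul_def (x y : Bicyclic) :
    x * y = ⟨x.fst + (max x.snd y.fst - x.snd), y.snd + (max x.snd y.fst - y.fst)⟩ := rfl

theorem Bicyclic.one_def : (1 : Bicyclic) = ⟨0, 0⟩ := rfl

instance : Monoid Bicyclic where
  mul_assoc x y z := by
    ext <;> simp only [Bicyclic.mul_def] <;> omega
  one_mul x := by
    ext <;> simp only [Bicyclic.mul_def, Bicyclic.one_def] <;> omega
  mul_one x := by
    ext <;> simp only [Bicyclic.mul_def, Bicyclic.one_def] <;> omega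

end MonoidAct

namespace MonoidAct

/-! Covers. An act with `(P)` is the disjoint union of locally cyclic components
(`componentSetoid`), so the construction reduces to nonempty locally cyclic acts over `A`
(`LocalObj`). If these are bounded in size, each maps to one out of which every morphism splits
(`exists_splitsOut`). Otherwise non-split morphisms could be composed transfinitely along a large
regular cardinal, with unions at limits. The union of the whole chain is again a bounded object, so
some stage is already isomorphic to it (`exists_inclBijective`), and the inverse isomorphism splits
the morphism chosen at that stage. Stages are encoded as subquotients of one fixed act, so that
direct limits are plain unions of relations. Any morphism between two objects of the split kind is
bijective, so the coproduct of one such object from each class, under existence of a morphism, is a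
cover (`hasCover_of_family`).

Submonoids. Extension of scalars `X ⊗ T` preserves `(P)`, `(E)` and local cyclicity, and contains
`X` (`Extension.injective_tmul_one`), so a bound for `T` is a bound for `S`.

Bicyclic monoid. Under `(P)` the action of `(1,0)` has finite fibres, which makes locally cyclic
acts countable. -/

theorem act_mul {S : Type u} [Monoid S] {X : Type w} [MulAction Sᵐᵒᵖ X] (x : X) (s t : S) :
    x <• (s * t) = x <• s <• t := by
  rw [MulOpposite.op_mul, mul_smul]

theorem act_one {S : Type u} [Monoid S] {X : Type w} [MulAction Sᵐᵒᵖ X] (x : X) :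
    x <• (1 : S) = x := by
  rw [MulOpposite.op_one, one_smul]

/-- Acts satisfying `(P)`, and also `(E)` if `e` holds: the choice `e = True` gives the strongly
flat acts, the choice `e = False` the acts with condition `(P)`. -/
def FlatClass (e : Prop) (S : Type u) [Monoid S] (X : Type w) [MulAction Sᵐᵒᵖ X] : Prop :=
  ConditionP S X ∧ (e → ConditionE S X)

/-! ### Extension of scalars from a submonoid -/

section Extension

variable {T : Type u} [Monoid T] (S : Submonoid T) {X : Type w} [MulAction (↥S)ᵐᵒᵖ X]

/-- For an act with condition `(P)`, two pairs are related if and only if the corresponding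
elementary tensors in `X ⊗ T` agree. -/
def extensionSetoid (hX : ConditionP S X) : Setoid (X × T) where
  r x y := ∃ (b : X) (s s' : S), x.1 = b <• s ∧ y.1 = b <• s' ∧ (s : T) * x.2 = s' * y.2
  iseqv :=
    { refl := fun x => ⟨x.1, 1, 1, (act_one _).symm, (act_one _).symm, rfl⟩
      symm := fun ⟨b, s, s', h, h', e⟩ => ⟨b, s', s, h', h, e.symm⟩
      trans := by
        rintro x y z ⟨b, s, s', h1, h2, h3⟩ ⟨c, r, r', h4, h5, h6⟩
        -- Transitivity is where `(P)` enters: it gives `b` and `c` a common source.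
        obtain ⟨d, k, l, h7, h8, h9⟩ := hX b c s' r (h2.symm.trans h4)
        refine ⟨d, k * s, l * r', by rw [h1, h7, act_mul], by rw [h5, h8, act_mul], ?_⟩
        have h9' : (k : T) * s' = l * r := by exact_mod_cast congrArg Subtype.val h9
        push_cast
        rw [mul_assoc, h3, ← mul_assoc, h9', mul_assoc, h6, mul_assoc] }

/-- The act `X ⊗ T` obtained from `X` by extension along the inclusion of `S` into `T`. -/
def Extension (hX : ConditionP S X) : Type (max u w) := Quotient (extensionSetoid S hX)

namespace Extension

variable {S} {hX : ConditionP S X}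

/-- The elementary tensor `x ⊗ t`. -/
def tmul (hX : ConditionP S X) (x : X) (t : T) : Extension S hX :=
  Quotient.mk (extensionSetoid S hX) (x, t)

theorem tmul_eq_tmul {x y : X} {t t' : T} : tmul hX x t = tmul hX y t' ↔
    ∃ (b : X) (s s' : S), x = b <• s ∧ y = b <• s' ∧ (s : T) * t = s' * t' :=
  Quotient.eq (r := extensionSetoid S hX)

theorem exists_tmul (z : Extension S hX) : ∃ x t, z = tmul hX x t :=
  Quotient.inductionOn z fun p => ⟨p.1, p.2, rfl⟩

instance : MulAction Tᵐᵒᵖ (Extension S hX) where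
  smul v := Quotient.map (fun p => (p.1, p.2 * v.unop)) (by
    rintro p q ⟨b, s, s', h, h', e⟩
    exact ⟨b, s, s', h, h', by simp only [← mul_assoc, e]⟩)
  one_smul z := by
    obtain ⟨x, t, rfl⟩ := exists_tmul z
    exact congrArg (tmul hX x) (mul_one t)
  mul_smul v v' z := by
    obtain ⟨x, t, rfl⟩ := exists_tmul z
    exact congrArg (tmul hX x) (mul_assoc t _ _).symm

theorem tmul_act (x : X) (t v : T) : tmul hX x t <• v = tmul hX x (t * v) := rfl

theorem act_tmul (x : X) (s : S) (t : T) : tmul hX (x <• s) t = tmul hX x (s * t) :=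
  tmul_eq_tmul.2 ⟨x, s, 1, rfl, (act_one _).symm, by simp⟩

theorem tmul_eq_act (x : X) (s : S) (t : T) :
    tmul hX (x <• s) t = tmul hX x 1 <• ((s : T) * t) := by
  rw [act_tmul, tmul_act, one_mul]

/-- The criterion for equality of tensors already has the shape of `(P)`; the common source is `b ⊗
1`. -/
theorem conditionP (hX : ConditionP S X) : ConditionP T (Extension S hX) := by
  intro a a' v v' h
  obtain ⟨x, t, rfl⟩ := exists_tmul a
  obtain ⟨x', t', rfl⟩ := exists_tmul a'
  obtain ⟨b, s, s', rfl, rfl, e⟩ := tmul_eq_tmul.1 h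
  exact ⟨tmul hX b 1, s * t, s' * t', tmul_eq_act _ _ _, tmul_eq_act _ _ _, by
    simpa only [mul_assoc, MulOpposite.unop_op] using e⟩

theorem conditionE (hX : ConditionP S X) (hE : ConditionE S X) :
    ConditionE T (Extension S hX) := by
  intro a v v' h
  obtain ⟨x, t, rfl⟩ := exists_tmul a
  obtain ⟨b, s, s', rfl, h', e⟩ := tmul_eq_tmul.1 h
  -- Both tensors have the same left factor, so `b s = b s'`; `(E)` in `X` gives an `r` that
  -- equalises `s` and `s'`.
  obtain ⟨c, r, rfl, hr⟩ := hE b s s' h'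
  have hr' : (r : T) * s = r * s' := by exact_mod_cast congrArg Subtype.val hr
  refine ⟨tmul hX c 1, r * s * t, ?_, ?_⟩
  · rw [← act_mul, tmul_eq_act]; push_cast; rfl
  · have e' : (s : T) * (t * v) = s' * (t * v') := e
    calc (r : T) * s * t * v = r * (s * (t * v)) := by simp only [mul_assoc]
      _ = r * s' * (t * v') := by rw [e', mul_assoc]
      _ = r * s * t * v' := by rw [← hr', mul_assoc _ t]

theorem flatClass {e : Prop} (h : FlatClass e S X) : FlatClass e T (Extension S h.1) :=
  ⟨conditionP _, fun he => conditionE _ (h.2 he)⟩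

theorem locallyCyclic (hX : ConditionP S X) (h : LocallyCyclic S X) :
    LocallyCyclic T (Extension S hX) := by
  intro a a'
  obtain ⟨x, t, rfl⟩ := exists_tmul a
  obtain ⟨x', t', rfl⟩ := exists_tmul a'
  obtain ⟨z, s, s', rfl, rfl⟩ := h x x'
  exact ⟨tmul hX z 1, s * t, s' * t', tmul_eq_act _ _ _, tmul_eq_act _ _ _⟩

/-- Equality of `x ⊗ 1` and `y ⊗ 1` forces `s = s'` in `T`, hence in `S`, as the inclusion is
injective. -/
theorem injective_tmul_one (hX : ConditionP S X) : Function.Injective fun x => tmul hX x 1 := by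
  intro x y h
  obtain ⟨b, s, s', rfl, rfl, e⟩ := tmul_eq_tmul.1 h
  rw [mul_one, mul_one] at e
  rw [Subtype.ext e]

end Extension

end Extension

/-! ### Bounded classes, treated uniformly in `e` -/

theorem stronglyFlat_iff {S : Type u} [Monoid S] {X : Type w} [MulAction Sᵐᵒᵖ X] :
    StronglyFlat S X ↔ FlatClass True S X := by
  simp [StronglyFlat, FlatClass]

theorem conditionP_iff {S : Type u} [Monoid S] {X : Type w} [MulAction Sᵐᵒᵖ X] :
    ConditionP S X ↔ FlatClass False S X := by
  simp [FlatClass]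

/-- The locally cyclic acts in `FlatClass e` are bounded in size. -/
def FlatBounded (e : Prop) (S : Type u) [Monoid S] : Prop :=
  LocallyCyclicBounded.{u, w} S (fun X _ => FlatClass e S X)

theorem classMSF_iff {S : Type u} [Monoid S] :
    ClassMSF.{u, w} S ↔ FlatBounded.{u, w} True S := by
  simp only [ClassMSF, FlatBounded, stronglyFlat_iff]

theorem classMCP_iff {S : Type u} [Monoid S] :
    ClassMCP.{u, w} S ↔ FlatBounded.{u, w} False S := by
  simp only [ClassMCP, FlatBounded, conditionP_iff]

theorem FlatBounded.of_false {e : Prop} {S : Type u} [Monoid S] (h : FlatBounded.{u, w} False S) :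
    FlatBounded.{u, w} e S := by
  obtain ⟨κ, hκ⟩ := h
  exact ⟨κ, fun X _ hX hl => hκ X (conditionP_iff.1 hX.1) hl⟩

theorem FlatBounded.submonoid {e : Prop} {T : Type u} [Monoid T]
    (h : FlatBounded.{u, max u v} e T) (S : Submonoid T) : FlatBounded.{u, max u v} e S := by
  obtain ⟨κ, hκ⟩ := h
  refine ⟨κ, fun X _ hX hl => ?_⟩
  have h1 := hκ (Extension S hX.1) (Extension.flatClass hX) (Extension.locallyCyclic _ hl)
  exact (Cardinal.mk_le_of_injective (Extension.injective_tmul_one hX.1)).trans_lt h1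

/-! ### Locally cyclic acts over the bicyclic monoid -/

namespace Bicyclic

theorem pow_mul_pow_inv (n : ℕ) : (⟨0, n⟩ : Bicyclic) * ⟨n, 0⟩ = 1 := by
  simp [mul_def, one_def]

theorem mk_eq_mul (a b : ℕ) : (⟨a, b⟩ : Bicyclic) = ⟨a, 0⟩ * ⟨0, b⟩ := by
  simp [mul_def]

/-- Right multiplication by `(1,0)` sends `(a,b+1)` to `(a,b)` and `(a,0)` to `(a+1,0)`, so its only
collisions are between `(a,0)` and `(a+1,1) = (a,0)(1,1)`. -/
theorem eq_of_mul_eq {s t : Bicyclic} (h : s * ⟨1, 0⟩ = t * ⟨1, 0⟩) :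
    s = t ∨ s = t * ⟨1, 1⟩ ∨ t = s * ⟨1, 1⟩ := by
  obtain ⟨a, b⟩ := s
  obtain ⟨c, d⟩ := t
  simp only [mul_def, Bicyclic.mk.injEq] at *
  omega

variable {X : Type w} [MulAction Bicyclicᵐᵒᵖ X]

/-- By `(P)` two distinct preimages of `w` come from a collision in the monoid, and then one of them
is `w(0,1)`. So there are at most two. -/
theorem finite_preimage (hX : ConditionP Bicyclic X) (w : X) :
    {z : X | z <• (⟨1, 0⟩ : Bicyclic) = w}.Finite := by
  have key : ∀ z z' : X, z <• (⟨1, 0⟩ : Bicyclic) = w → z' <• (⟨1, 0⟩ : Bicyclic) = w →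
      z = z' ∨ z = w <• (⟨0, 1⟩ : Bicyclic) ∨ z' = w <• (⟨0, 1⟩ : Bicyclic) := by
    intro z z' hz hz'
    obtain ⟨b, s, s', rfl, rfl, h⟩ := hX z z' _ _ (hz.trans hz'.symm)
    rcases eq_of_mul_eq h with rfl | rfl | rfl
    · exact Or.inl rfl
    · right; left
      rw [← hz', ← act_mul, ← act_mul, mk_eq_mul 1 1]
    · right; right
      rw [← hz, ← act_mul, ← act_mul, mk_eq_mul 1 1]
  by_cases h : ∃ z : X, z <• (⟨1, 0⟩ : Bicyclic) = w ∧ z ≠ w <• (⟨0, 1⟩ : Bicyclic)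
  · obtain ⟨z, hz, hne⟩ := h
    refine (Set.toFinite {z, w <• (⟨0, 1⟩ : Bicyclic)}).subset fun z' hz' => ?_
    rcases key z z' hz hz' with h | h | h
    · exact Or.inl h.symm
    · exact absurd h hne
    · exact Or.inr h
  · push Not at h
    exact (Set.finite_singleton (w <• (⟨0, 1⟩ : Bicyclic))).subset h

theorem countable_preimage (hX : ConditionP Bicyclic X) (n : ℕ) (w : X) :
    {z : X | z <• (⟨n, 0⟩ : Bicyclic) = w}.Countable := by
  induction n generalizing w with
  | zero =>
    refine (Set.countable_singleton w).mono fun z hz => ?_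
    exact (act_one (S := Bicyclic) z).symm.trans hz
  | succ n ih =>
    have h := (ih w).biUnion fun y _ => (finite_preimage hX y).countable
    refine h.mono fun z hz => ?_
    refine Set.mem_biUnion (x := z <• (⟨1, 0⟩ : Bicyclic)) ?_ rfl
    have : (⟨n + 1, 0⟩ : Bicyclic) = ⟨1, 0⟩ * ⟨n, 0⟩ := by
      simp [mul_def, Nat.add_comm]
    rw [Set.mem_ofPred_eq, ← act_mul, ← this]
    exact hz

/-- Fix `x`. If `x = z(a,b)` and `y = z(c,d)`, then `(0,b)(b,0) = 1` gives `z(a,0) = x(b,0)`. So `z`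
lies in one of countably many countable fibres, and `y` is determined by `z`, `c`, `d`. -/
theorem countable_of_locallyCyclic (hX : ConditionP Bicyclic X) (hl : LocallyCyclic Bicyclic X) :
    Countable X := by
  rcases isEmpty_or_nonempty X with _ | ⟨⟨x⟩⟩
  · infer_instance
  have h : (⋃ (i : ℕ × ℕ) (s : ℕ × ℕ),
      (fun z : X => z <• (⟨s.1, s.2⟩ : Bicyclic)) ''
        {z : X | z <• (⟨i.1, 0⟩ : Bicyclic) = x <• (⟨i.2, 0⟩ : Bicyclic)}).Countable :=
    Set.countable_iUnion fun i => Set.countable_iUnion fun s =>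
      (countable_preimage hX _ _).image _
  refine Set.countable_univ_iff.1 (h.mono fun y _ => ?_)
  obtain ⟨z, ⟨a, b⟩, ⟨c, d⟩, rfl, rfl⟩ := hl x y
  refine Set.mem_iUnion.2 ⟨(a, b), Set.mem_iUnion.2 ⟨(c, d), z, ?_, rfl⟩⟩
  rw [Set.mem_ofPred_eq, ← act_mul, mk_eq_mul a b, mul_assoc, pow_mul_pow_inv, mul_one]

theorem flatBounded (e : Prop) : FlatBounded.{0, w} e Bicyclic := by
  refine FlatBounded.of_false ⟨Order.succ Cardinal.aleph0, fun X _ hX hl => ?_⟩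
  have := countable_of_locallyCyclic hX.1 hl
  exact Order.lt_succ_of_le (Cardinal.mk_le_aleph0)

end Bicyclic

end MonoidAct

/-! ### Locally cyclic acts over `A` and their presentation as subquotients -/

namespace MonoidAct

/-- A nonempty locally cyclic act in `FlatClass e` with an `S`-map to `A`. -/
structure LocalObj (S : Type u) [Monoid S] (e : Prop) (A : Type w) [MulAction Sᵐᵒᵖ A] :
    Type (max u (w + 1)) where
  /-- the underlying act -/
  carrier : Type w
  [act : MulAction Sᵐᵒᵖ carrier]
  /-- the structure map -/
  map : carrier →[Sᵐᵒᵖ] A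
  nonempty : Nonempty carrier
  flat : FlatClass e S carrier
  cyclic : LocallyCyclic S carrier

attribute [instance] LocalObj.act

section

variable {S : Type u} [Monoid S] {e : Prop} {A : Type w} [MulAction Sᵐᵒᵖ A]

namespace LocalObj

/-- Morphisms over `A`. -/
def Hom (M N : LocalObj S e A) : Type w :=
  {f : M.carrier →[Sᵐᵒᵖ] N.carrier // ∀ x, N.map (f x) = M.map x}

/-- Composition of morphisms over `A`. -/
def Hom.comp {M N L : LocalObj S e A} (g : Hom N L) (f : Hom M N) : Hom M L :=
  ⟨g.1.comp f.1, fun x => (g.2 _).trans (f.2 x)⟩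

/-- Every morphism out of `M` is a split monomorphism. -/
def SplitsOut (M : LocalObj S e A) : Prop :=
  ∀ (N : LocalObj S e A) (f : Hom M N), ∃ r : Hom N M, ∀ x, r.1 (f.1 x) = x

theorem SplitsOut.injective {M N : LocalObj S e A} (hM : M.SplitsOut) (f : Hom M N) :
    Function.Injective f.1 := by
  obtain ⟨r, hr⟩ := hM N f
  exact Function.LeftInverse.injective (g := r.1) hr

/-- A retraction of `f` is itself a morphism out of `N`, hence injective, which makes `f`
surjective. -/
theorem SplitsOut.bijective {M N : LocalObj S e A} (hM : M.SplitsOut) (hN : N.SplitsOut)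
    (f : Hom M N) : Function.Bijective f.1 := by
  refine ⟨hM.injective f, fun y => ?_⟩
  obtain ⟨r, hr⟩ := hM N f
  exact ⟨r.1 y, hN.injective r (hr _)⟩

end LocalObj

/-- A partial equivalence relation on `F` whose quotient is a locally cyclic act over `A` that
belongs to `FlatClass e`. -/
structure IsSubquotient (e : Prop) {F : Type w} [MulAction Sᵐᵒᵖ F] (g : F →[Sᵐᵒᵖ] A)
    (r : F → F → Prop) : Prop where
  symm : ∀ {x y}, r x y → r y x
  trans : ∀ {x y z}, r x y → r y z → r x z
  act : ∀ {x y} (s : S), r x y → r (x <• s) (y <• s)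
  map_eq : ∀ {x y}, r x y → g x = g y
  nonempty : ∃ x, r x x
  condP : ∀ {x y} {t t' : S}, r x x → r y y → r (x <• t) (y <• t') →
    ∃ (b : F) (s s' : S), r b b ∧ r x (b <• s) ∧ r y (b <• s') ∧ s * t = s' * t'
  condE : e → ∀ {x} {t t' : S}, r x x → r (x <• t) (x <• t') →
    ∃ (b : F) (s : S), r b b ∧ r x (b <• s) ∧ s * t = s * t'
  cyclic : ∀ {x y}, r x x → r y y →
    ∃ (z : F) (s t : S), r z z ∧ r x (z <• s) ∧ r y (z <• t)

namespace IsSubquotient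

variable {F : Type w} [MulAction Sᵐᵒᵖ F] {g : F →[Sᵐᵒᵖ] A} {r r' : F → F → Prop}

theorem left (h : IsSubquotient e g r) {x y : F} (hxy : r x y) : r x x :=
  h.trans hxy (h.symm hxy)

theorem right (h : IsSubquotient e g r) {x y : F} (hxy : r x y) : r y y :=
  h.trans (h.symm hxy) hxy

/-- The equivalence relation induced on the domain of a subquotient. -/
def setoid (h : IsSubquotient e g r) : Setoid {x // r x x} where
  r x y := r x y
  iseqv := ⟨fun x => x.2, h.symm, h.trans⟩

/-- The underlying type of a subquotient. -/
def Quot (h : IsSubquotient e g r) : Type w := Quotient h.setoid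

/-- The class of an element of the domain. -/
def proj (h : IsSubquotient e g r) (x : F) (hx : r x x) : h.Quot :=
  Quotient.mk h.setoid ⟨x, hx⟩

theorem proj_eq_proj (h : IsSubquotient e g r) {x y : F} {hx : r x x} {hy : r y y} :
    h.proj x hx = h.proj y hy ↔ r x y :=
  Quotient.eq (r := h.setoid)

theorem exists_proj (h : IsSubquotient e g r) (q : h.Quot) : ∃ x hx, q = h.proj x hx :=
  Quotient.inductionOn q fun x => ⟨x.1, x.2, rfl⟩

instance (h : IsSubquotient e g r) : MulAction Sᵐᵒᵖ h.Quot where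
  smul s := Quotient.map (fun x => ⟨x.1 <• s.unop, h.act _ x.2⟩) fun _ _ hxy => h.act _ hxy
  one_smul q := by
    obtain ⟨x, hx, rfl⟩ := h.exists_proj q
    refine h.proj_eq_proj.2 ?_
    change r (x <• (1 : S)) x
    rwa [act_one]
  mul_smul s t q := by
    obtain ⟨x, hx, rfl⟩ := h.exists_proj q
    refine h.proj_eq_proj.2 ?_
    change r (x <• (t.unop * s.unop)) (x <• t.unop <• s.unop)
    rw [act_mul]
    exact h.act _ (h.act _ hx)

/-- The locally cyclic act over `A` presented by a subquotient. -/
def toObj (h : IsSubquotient e g r) : LocalObj S e A where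
  carrier := h.Quot
  map :=
    { toFun := Quotient.lift (fun x => g x.1) fun _ _ hxy => h.map_eq hxy
      map_smul' := fun s q => by
        obtain ⟨x, hx, rfl⟩ := h.exists_proj q
        exact map_smul g s x }
  nonempty := let ⟨x, hx⟩ := h.nonempty; ⟨h.proj x hx⟩
  flat := by
    refine ⟨fun a a' t t' hq => ?_, fun he a t t' hq => ?_⟩
    · obtain ⟨x, hx, rfl⟩ := h.exists_proj a
      obtain ⟨y, hy, rfl⟩ := h.exists_proj a'
      obtain ⟨b, s, s', hb, h1, h2, h3⟩ := h.condP hx hy (h.proj_eq_proj.1 hq)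
      exact ⟨h.proj b hb, s, s', h.proj_eq_proj.2 h1, h.proj_eq_proj.2 h2, h3⟩
    · obtain ⟨x, hx, rfl⟩ := h.exists_proj a
      obtain ⟨b, s, hb, h1, h3⟩ := h.condE he hx (h.proj_eq_proj.1 hq)
      exact ⟨h.proj b hb, s, h.proj_eq_proj.2 h1, h3⟩
  cyclic := fun a a' => by
    obtain ⟨x, hx, rfl⟩ := h.exists_proj a
    obtain ⟨y, hy, rfl⟩ := h.exists_proj a'
    obtain ⟨b, s, s', hb, h1, h2⟩ := h.cyclic hx hy
    exact ⟨h.proj b hb, s, s', h.proj_eq_proj.2 h1, h.proj_eq_proj.2 h2⟩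

/-- The morphism given by an inclusion of subquotients. -/
def incl (h : IsSubquotient e g r) (h' : IsSubquotient e g r') (hle : ∀ x y, r x y → r' x y) :
    LocalObj.Hom h.toObj h'.toObj :=
  ⟨{ toFun := Quotient.map (fun x => ⟨x.1, hle _ _ x.2⟩) fun _ _ hxy => hle _ _ hxy
     map_smul' := fun s q => by
      obtain ⟨x, hx, rfl⟩ := h.exists_proj q
      rfl },
   fun q => by
    obtain ⟨x, hx, rfl⟩ := h.exists_proj q
    rfl⟩

/-- A partial equivariant surjection from `F` to an object over `A` presents it as a
subquotient of `F`. -/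
theorem of_graph (N : LocalObj S e A) {G : F → N.carrier → Prop}
    (functional : ∀ {x n n'}, G x n → G x n' → n = n')
    (act : ∀ {x n} (s : S), G x n → G (x <• s) (n <• s))
    (surj : ∀ n, ∃ x, G x n) (map_graph : ∀ {x n}, G x n → N.map n = g x) :
    IsSubquotient e g fun x y => ∃ n, G x n ∧ G y n where
  symm := fun ⟨n, h, h'⟩ => ⟨n, h', h⟩
  trans := by
    rintro x y z ⟨n, h, h'⟩ ⟨m, k, k'⟩
    obtain rfl := functional h' k
    exact ⟨n, h, k'⟩
  act := fun s ⟨n, h, h'⟩ => ⟨n <• s, act s h, act s h'⟩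
  map_eq := fun ⟨n, h, h'⟩ => (map_graph h).symm.trans (map_graph h')
  nonempty := by
    obtain ⟨n⟩ := N.nonempty
    obtain ⟨x, hx⟩ := surj n
    exact ⟨x, n, hx, hx⟩
  condP := by
    rintro x y t t' ⟨n, hx, -⟩ ⟨m, hy, -⟩ ⟨k, h1, h2⟩
    obtain ⟨b, s, s', rfl, rfl, h⟩ := N.flat.1 n m t t'
      ((functional (act t hx) h1).trans (functional (act t' hy) h2).symm)
    obtain ⟨z, hz⟩ := surj b
    exact ⟨z, s, s', ⟨b, hz, hz⟩, ⟨_, hx, act s hz⟩, ⟨_, hy, act s' hz⟩, h⟩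
  condE := by
    rintro he x t t' ⟨n, hx, -⟩ ⟨k, h1, h2⟩
    obtain ⟨b, s, rfl, h⟩ := N.flat.2 he n t t'
      ((functional (act t hx) h1).trans (functional (act t' hx) h2).symm)
    obtain ⟨z, hz⟩ := surj b
    exact ⟨z, s, ⟨b, hz, hz⟩, ⟨_, hx, act s hz⟩, h⟩
  cyclic := by
    rintro x y ⟨n, hx, -⟩ ⟨m, hy, -⟩
    obtain ⟨b, s, k, rfl, rfl⟩ := N.cyclic n m
    obtain ⟨z, hz⟩ := surj b
    exact ⟨z, s, k, ⟨b, hz, hz⟩, ⟨_, hx, act s hz⟩, ⟨_, hy, act k hz⟩⟩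

/-- The union of a directed family of subquotients is a subquotient. -/
theorem iUnion {ι : Type*} [Nonempty ι] {R : ι → F → F → Prop}
    (hR : ∀ i, IsSubquotient e g (R i)) (hdir : Directed (· ≤ ·) R) :
    IsSubquotient e g fun x y => ∃ i, R i x y where
  symm := fun ⟨i, h⟩ => ⟨i, (hR i).symm h⟩
  trans := by
    rintro x y z ⟨i, hi⟩ ⟨j, hj⟩
    obtain ⟨k, hik, hjk⟩ := hdir i j
    exact ⟨k, (hR k).trans (hik _ _ hi) (hjk _ _ hj)⟩
  act := fun s ⟨i, h⟩ => ⟨i, (hR i).act s h⟩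
  map_eq := fun ⟨i, h⟩ => (hR i).map_eq h
  nonempty := by
    obtain ⟨i⟩ := ‹Nonempty ι›
    obtain ⟨x, hx⟩ := (hR i).nonempty
    exact ⟨x, i, hx⟩
  condP := by
    -- Only finitely many relations are involved, so they all hold at a single index.
    rintro x y t t' ⟨i, hi⟩ ⟨j, hj⟩ ⟨k, hk⟩
    obtain ⟨l, hil, hjl⟩ := hdir i j
    obtain ⟨m, hlm, hkm⟩ := hdir l k
    obtain ⟨b, s, s', h1, h2, h3, h4⟩ := (hR m).condP (hlm _ _ (hil _ _ hi))
      (hlm _ _ (hjl _ _ hj)) (hkm _ _ hk)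
    exact ⟨b, s, s', ⟨m, h1⟩, ⟨m, h2⟩, ⟨m, h3⟩, h4⟩
  condE := by
    rintro he x t t' ⟨i, hi⟩ ⟨k, hk⟩
    obtain ⟨m, him, hkm⟩ := hdir i k
    obtain ⟨b, s, h1, h2, h4⟩ := (hR m).condE he (him _ _ hi) (hkm _ _ hk)
    exact ⟨b, s, ⟨m, h1⟩, ⟨m, h2⟩, h4⟩
  cyclic := by
    rintro x y ⟨i, hi⟩ ⟨j, hj⟩
    obtain ⟨m, him, hjm⟩ := hdir i j
    obtain ⟨z, s, t, h1, h2, h3⟩ := (hR m).cyclic (him _ _ hi) (hjm _ _ hj)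
    exact ⟨z, s, t, ⟨m, h1⟩, ⟨m, h2⟩, ⟨m, h3⟩⟩

end IsSubquotient

/-- The inclusion of `r` into `r'` induces a bijection of the quotients. -/
def InclBijective {F : Type w} (r r' : F → F → Prop) : Prop :=
  (∀ x y, r x x → r y y → r' x y → r x y) ∧ ∀ y, r' y y → ∃ x, r x x ∧ r' x y

theorem IsSubquotient.bijective_incl {F : Type w} [MulAction Sᵐᵒᵖ F] {g : F →[Sᵐᵒᵖ] A}
    {r r' : F → F → Prop} (h : IsSubquotient e g r) (h' : IsSubquotient e g r')
    (hle : ∀ x y, r x y → r' x y) (hb : InclBijective r r') :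
    Function.Bijective (h.incl h' hle).1 := by
  refine ⟨fun a b hab => ?_, fun b => ?_⟩
  · obtain ⟨x, hx, rfl⟩ := h.exists_proj a
    obtain ⟨y, hy, rfl⟩ := h.exists_proj b
    exact h.proj_eq_proj.2 (hb.1 _ _ hx hy (h'.proj_eq_proj.1 hab))
  · obtain ⟨y, hy, rfl⟩ := h'.exists_proj b
    obtain ⟨x, hx, hxy⟩ := hb.2 y hy
    exact ⟨h.proj x hx, h'.proj_eq_proj.2 hxy⟩

/-- The inverse of a bijective morphism over `A`. -/
theorem LocalObj.Hom.exists_inverse {M N : LocalObj S e A} (f : LocalObj.Hom M N)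
    (hf : Function.Bijective f.1) :
    ∃ r : LocalObj.Hom N M, (∀ x, r.1 (f.1 x) = x) ∧ ∀ y, f.1 (r.1 y) = y := by
  obtain ⟨k, h1, h2⟩ := Function.bijective_iff_has_inverse.1 hf
  refine ⟨⟨f.1.inverse k h1 h2, fun y => ?_⟩, h1, h2⟩
  rw [← f.2]
  exact congrArg N.map (h2 y)

/-! ### One step of the transfinite chain -/

section Chain

variable {W K : Type w} [LinearOrder W] [MulAction Sᵐᵒᵖ K]

/-- The `S`-map on a disjoint union of copies of `K`. -/
def copiesMap (W : Type w) (gK : K →[Sᵐᵒᵖ] A) : (Σ _ : W, K) →[Sᵐᵒᵖ] A where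
  toFun x := gK x.2
  map_smul' s x := map_smul gK s x.2

/-- The relation `r'` is a subquotient extending `r`, supported on the levels up to `α`, and receiving a
morphism from `X`, which no larger subquotient retracts to `r`. -/
structure IsStep (X : LocalObj S e A) (gK : K →[Sᵐᵒᵖ] A) (α : W)
    (r r' : (Σ _ : W, K) → (Σ _ : W, K) → Prop) : Prop where
  sub : IsSubquotient e (copiesMap W gK) r'
  hom : Nonempty (LocalObj.Hom X sub.toObj)
  supp : ∀ x, r' x x → x.1 ≤ α
  le : ∀ x y, r x y → r' x y
  not_bij : ∀ r'', IsSubquotient e (copiesMap W gK) r'' → (∀ x y, r' x y → r'' x y) →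
    ¬ InclBijective r r''

variable {X : LocalObj S e A} {gK : K →[Sᵐᵒᵖ] A}

theorem exists_isStep_of_empty
    (hK : ∀ N : LocalObj S e A, ∃ ψ : N.carrier →[Sᵐᵒᵖ] K,
      Function.Injective ψ ∧ ∀ n, gK (ψ n) = N.map n)
    (α : W) {r : (Σ _ : W, K) → (Σ _ : W, K) → Prop} (hr : ∀ x y, ¬ r x y) :
    ∃ r', IsStep X gK α r r' := by
  obtain ⟨ψ, hψ, hψg⟩ := hK X
  have sub : IsSubquotient e (copiesMap W gK) fun x y => ∃ n, x = ⟨α, ψ n⟩ ∧ y = ⟨α, ψ n⟩ :=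
    IsSubquotient.of_graph X (G := fun (x : Σ _ : W, K) n => x = ⟨α, ψ n⟩)
      (by
        rintro x n n' rfl h
        exact hψ (by simpa using h))
      (by
        rintro x n s rfl
        simp)
      (fun n => ⟨_, rfl⟩)
      (by
        rintro x n rfl
        exact (hψg n).symm)
  refine ⟨_, sub, ⟨⟨⟨fun n => sub.proj ⟨α, ψ n⟩ ⟨n, rfl, rfl⟩, fun s n => ?_⟩, fun n => hψg n⟩⟩,
    ?_, fun x y h => absurd h (hr x y), fun r'' h'' _ hb => ?_⟩
  · refine sub.proj_eq_proj.2 ⟨s • n, rfl, ?_⟩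
    simp
  · rintro x ⟨n, rfl, -⟩
    exact le_rfl
  · obtain ⟨y, hy⟩ := h''.nonempty
    obtain ⟨x, hx, -⟩ := hb.2 y hy
    exact hr _ _ hx

/-- The object of `r` receives a morphism from `X`, so it has a non-split morphism `φ` to some `N`.
A fresh copy of `N` is put at level `α`, with old elements identified with their images under `φ`. A
larger subquotient in bijection with `r` would yield a retraction of `φ`. -/
theorem exists_isStep
    (hK : ∀ N : LocalObj S e A, ∃ ψ : N.carrier →[Sᵐᵒᵖ] K,
      Function.Injective ψ ∧ ∀ n, gK (ψ n) = N.map n)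
    (hX : ∀ M : LocalObj S e A, Nonempty (LocalObj.Hom X M) → ¬ M.SplitsOut)
    (α : W) {r : (Σ _ : W, K) → (Σ _ : W, K) → Prop}
    (h : IsSubquotient e (copiesMap W gK) r) (hom : Nonempty (LocalObj.Hom X h.toObj))
    (hsupp : ∀ x, r x x → x.1 < α) : ∃ r', IsStep X gK α r r' := by
  have hns := hX _ hom
  simp only [LocalObj.SplitsOut, not_forall] at hns
  obtain ⟨N, φ, hφ⟩ := hns
  obtain ⟨ψ, hψ, hψg⟩ := hK N
  have sub := IsSubquotient.of_graph (g := copiesMap W gK) N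
      (G := fun (x : Σ _ : W, K) n => (∃ hx : r x x, φ.1 (h.proj x hx) = n) ∨ x = ⟨α, ψ n⟩)
      (by
        -- Old elements live strictly below level `α`, so the two clauses of `G` never overlap.
        rintro x n n' (⟨hx, rfl⟩ | rfl) (⟨hx', h'⟩ | h')
        · exact h'
        · subst h'
          exact absurd (hsupp _ hx) (lt_irrefl _)
        · exact absurd (hsupp _ hx') (lt_irrefl _)
        · exact hψ (by simpa using h'))
      (by
        rintro x n s (⟨hx, rfl⟩ | rfl)
        · exact Or.inl ⟨h.act s hx, (map_smul φ.1 (MulOpposite.op s) (h.proj x hx))⟩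
        · right
          simp)
      (fun n => ⟨_, Or.inr rfl⟩)
      (by
        rintro x n (⟨hx, rfl⟩ | rfl)
        · exact φ.2 _
        · exact (hψg n).symm)
  have hle : ∀ x y, r x y → ∃ n, ((∃ hx : r x x, φ.1 (h.proj x hx) = n) ∨ x = ⟨α, ψ n⟩) ∧
      ((∃ hy : r y y, φ.1 (h.proj y hy) = n) ∨ y = ⟨α, ψ n⟩) := fun x y hxy =>
    ⟨φ.1 (h.proj x (h.left hxy)), Or.inl ⟨h.left hxy, rfl⟩, Or.inl ⟨h.right hxy, by
      rw [h.proj_eq_proj.2 hxy]⟩⟩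
  refine ⟨_, sub, hom.map (h.incl sub hle).comp, ?_, hle, fun r'' h'' hle' hb => hφ ?_⟩
  · rintro x ⟨n, ⟨hx, rfl⟩ | rfl, -⟩
    · exact (hsupp x hx).le
    · exact le_rfl
  · have hle2 : ∀ x y, r x y → r'' x y := fun x y hxy => hle' _ _ (hle _ _ hxy)
    obtain ⟨k, hk1, hk2⟩ := LocalObj.Hom.exists_inverse _ (h.bijective_incl h'' hle2 hb)
    -- `N` maps to `r''` through its copy at level `α`; following this with the inverse `k` of the
    -- inclusion retracts `φ`.
    let j : LocalObj.Hom N h''.toObj :=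
      ⟨⟨fun n => h''.proj ⟨α, ψ n⟩ (hle' _ _ ⟨n, Or.inr rfl, Or.inr rfl⟩), fun s n => by
        refine h''.proj_eq_proj.2 (hle' _ _ ⟨s • n, Or.inr rfl, Or.inr ?_⟩)
        simp⟩, fun n => hψg n⟩
    refine ⟨k.comp j, fun q => ?_⟩
    obtain ⟨x, hx, rfl⟩ := h.exists_proj q
    have : j.1 (φ.1 (h.proj x hx)) = (h.incl h'' hle2).1 (h.proj x hx) :=
      h''.proj_eq_proj.2 (hle' _ _ ⟨φ.1 (h.proj x hx), Or.inr rfl, Or.inl ⟨hx, rfl⟩⟩)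
    exact (congrArg k.1 this).trans (hk1 _)

end Chain

end

end MonoidAct

/-! ### Stabilisation of long chains -/

namespace MonoidAct

theorem exists_strict_bound {κ : Cardinal.{w}} (hκ : κ.IsRegular) {ι : Type w}
    (f : ι → κ.ord.ToType) (h : Cardinal.mk ι < κ) : ∃ b, ∀ i, f i < b := by
  contrapose! h
  rw [← hκ.cof_ord, ← Ordinal.cof_toType]
  refine (Order.cof_le (s := Set.range f) fun j => ?_).trans Cardinal.mk_range_le
  obtain ⟨i, hi⟩ := h j
  exact ⟨_, Set.mem_range_self i, hi⟩

section

variable {S : Type u} [Monoid S] {e : Prop} {A : Type w} [MulAction Sᵐᵒᵖ A]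

/-- A continuous chain of subquotients of length `W` has, below some index, the same quotient as
its union, provided that `W` has large cofinality. -/
theorem exists_inclBijective {W F : Type w} [LinearOrder W] [WellFoundedLT W] [Nonempty W]
    [MulAction Sᵐᵒᵖ F] {g : F →[Sᵐᵒᵖ] A} {κ : Cardinal.{w}} (hκ : Cardinal.aleph0 < κ)
    (hcard : ∀ M : LocalObj S e A, Cardinal.mk M.carrier < κ)
    (hW : ∀ {ι : Type w} (f : ι → W), Cardinal.mk ι < κ → ∃ b, ∀ i, f i < b)
    {R : W → F → F → Prop} (hR : ∀ α, IsSubquotient e g (R α)) (hmono : Monotone R) :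
    ∃ γ, InclBijective (fun x y => ∃ β : {β // β < γ}, R β.1 x y) (fun x y => ∃ α, R α x y) := by
  have htot : IsSubquotient e g fun x y => ∃ α, R α x y :=
    IsSubquotient.iUnion hR hmono.directed_le
  -- The total quotient has fewer than `κ` classes, so all of them are represented by one stage.
  obtain ⟨β₀, hβ₀⟩ : ∃ β, ∀ y, (∃ α, R α y y) → ∃ x, R β x x ∧ ∃ α, R α x y := by
    have hq : ∀ q : htot.Quot, ∃ α x hx, R α x x ∧ q = htot.proj x hx := fun q => by
      obtain ⟨x, ⟨α, hx⟩, rfl⟩ := htot.exists_proj q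
      exact ⟨α, x, ⟨α, hx⟩, hx, rfl⟩
    choose f x hx hRx hq using hq
    obtain ⟨b, hb⟩ := hW f (hcard htot.toObj)
    exact ⟨b, fun y hy => ⟨x (htot.proj y hy), hmono (hb _).le _ _ (hRx _),
      htot.proj_eq_proj.1 (hq (htot.proj y hy)).symm⟩⟩
  -- Stage `β` has fewer than `κ` pairs of classes, so every identification ever made between them
  -- is made by a single later stage.
  have hnext : ∀ β, ∃ β', ∀ x y, R β x x → R β y y → (∃ α, R α x y) → R β' x y := by
    intro β
    have hp : ∀ p : (hR β).Quot × (hR β).Quot, ∃ α, ∀ x y (hx : R β x x) (hy : R β y y),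
        p = ((hR β).proj x hx, (hR β).proj y hy) → (∃ α, R α x y) → R α x y := by
      rintro ⟨q, q'⟩
      obtain ⟨x₀, hx₀, rfl⟩ := (hR β).exists_proj q
      obtain ⟨y₀, hy₀, rfl⟩ := (hR β).exists_proj q'
      by_cases h : ∃ α, R α x₀ y₀
      · obtain ⟨α, hα⟩ := h
        refine ⟨max α β, fun x y hx hy he _ => ?_⟩
        rw [Prod.mk.injEq, (hR β).proj_eq_proj, (hR β).proj_eq_proj] at he
        have h1 := hmono (le_max_right α β) _ _ he.1
        have h2 := hmono (le_max_right α β) _ _ he.2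
        exact (hR _).trans ((hR _).symm h1)
          ((hR _).trans (hmono (le_max_left α β) _ _ hα) h2)
      -- This pair is never identified, so any index would do.
      · refine ⟨β, fun x y hx hy he hxy => absurd ?_ h⟩
        rw [Prod.mk.injEq, (hR β).proj_eq_proj, (hR β).proj_eq_proj] at he
        exact htot.trans ⟨β, he.1⟩ (htot.trans hxy (htot.symm ⟨β, he.2⟩))
    choose f hf using hp
    obtain ⟨b, hb⟩ := hW f (by
      rw [← Cardinal.mul_def]
      exact Cardinal.mul_lt_of_lt hκ.le (hcard (hR β).toObj) (hcard (hR β).toObj))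
    exact ⟨b, fun x y hx hy hxy => hmono (hb _).le _ _ (hf (_, _) x y hx hy rfl hxy)⟩
  choose next hnext using hnext
  have hbd : ∃ γ, ∀ n : ℕ, next^[n] β₀ < γ := by
    obtain ⟨γ, hγ⟩ := hW (fun n : ULift.{w} ℕ => next^[n.down] β₀) (by simpa using hκ)
    exact ⟨γ, fun n => hγ ⟨n⟩⟩
  -- By minimality every index below `γ` is at most some iterate of `next`, so the stages below `γ`
  -- are closed under the identifications of the whole union.
  obtain ⟨γ, hγ, hmin⟩ := WellFounded.has_min (wellFounded_lt (α := W))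
    {γ | ∀ n : ℕ, next^[n] β₀ < γ} hbd
  refine ⟨γ, ?_, ?_⟩
  · rintro x y ⟨⟨δ, hδ⟩, hx⟩ ⟨⟨δ', hδ'⟩, hy⟩ hxy
    have hm : max δ δ' < γ := max_lt hδ hδ'
    obtain ⟨n, hn⟩ : ∃ n : ℕ, max δ δ' ≤ next^[n] β₀ := by
      by_contra hcon
      push Not at hcon
      exact hmin _ hcon hm
    have := hnext _ x y (hmono ((le_max_left _ _).trans hn) _ _ hx)
      (hmono ((le_max_right _ _).trans hn) _ _ hy) hxy
    rw [← Function.iterate_succ_apply' next] at this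
    exact ⟨⟨_, hγ (n + 1)⟩, this⟩
  · intro y hy
    obtain ⟨x, hx, hxy⟩ := hβ₀ y hy
    exact ⟨x, ⟨⟨β₀, hγ 0⟩, hx⟩, hxy⟩

section Chain

variable {W K : Type w} [LinearOrder W] [MulAction Sᵐᵒᵖ K]

open Classical in
/-- An extension of `r` at level `α` as in `IsStep`, if there is one. -/
noncomputable def step (X : LocalObj S e A) (gK : K →[Sᵐᵒᵖ] A) (α : W)
    (r : (Σ _ : W, K) → (Σ _ : W, K) → Prop) : (Σ _ : W, K) → (Σ _ : W, K) → Prop :=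
  if h : ∃ r', IsStep X gK α r r' then h.choose else r

variable [WellFoundedLT W]

/-- The chain of subquotients obtained by iterating `step`, taking unions in between. -/
noncomputable def chain (X : LocalObj S e A) (gK : K →[Sᵐᵒᵖ] A) :
    W → (Σ _ : W, K) → (Σ _ : W, K) → Prop :=
  (wellFounded_lt (α := W)).fix fun α R =>
    step X gK α fun x y => ∃ β : {β // β < α}, R β.1 β.2 x y

theorem chain_eq (X : LocalObj S e A) (gK : K →[Sᵐᵒᵖ] A) (α : W) :
    chain X gK α = step X gK α fun x y => ∃ β : {β // β < α}, chain X gK β.1 x y :=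
  WellFounded.fix_eq _ _ _

/-- Induction supplies what the next step needs: `le` makes the earlier stages directed, `supp`
leaves level `α` free, and `hom` carries the morphism from `X` to their union. -/
theorem isStep_chain {X : LocalObj S e A} {gK : K →[Sᵐᵒᵖ] A}
    (hK : ∀ N : LocalObj S e A, ∃ ψ : N.carrier →[Sᵐᵒᵖ] K,
      Function.Injective ψ ∧ ∀ n, gK (ψ n) = N.map n)
    (hX : ∀ M : LocalObj S e A, Nonempty (LocalObj.Hom X M) → ¬ M.SplitsOut) (α : W) :
    IsStep X gK α (fun x y => ∃ β : {β // β < α}, chain X gK β.1 x y) (chain X gK α) := by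
  induction α using WellFoundedLT.induction with
  | ind α ih =>
    have h : ∃ r', IsStep X gK α (fun x y => ∃ β : {β // β < α}, chain X gK β.1 x y) r' := by
      by_cases hα : ∃ β, β < α
      · obtain ⟨β, hβ⟩ := hα
        have : Nonempty {β // β < α} := ⟨⟨β, hβ⟩⟩
        have hmono : Monotone fun β : {β // β < α} => chain X gK β.1 := by
          intro β γ hβγ
          rcases hβγ.eq_or_lt with rfl | hlt
          · exact le_rfl
          · exact fun x y hxy => (ih γ.1 γ.2).le x y ⟨⟨β.1, hlt⟩, hxy⟩
        have hsub := IsSubquotient.iUnion (fun β : {β // β < α} => (ih β.1 β.2).sub)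
          hmono.directed_le
        refine exists_isStep hK hX α hsub
          ((ih β hβ).hom.map ((ih β hβ).sub.incl hsub fun x y hxy => ⟨⟨β, hβ⟩, hxy⟩).comp) ?_
        rintro x ⟨γ, hx⟩
        exact ((ih γ.1 γ.2).supp x hx).trans_lt γ.2
      · exact exists_isStep_of_empty hK α fun x y ⟨β, _⟩ => hα ⟨β.1, β.2⟩
    rw [chain_eq, step, dif_pos h]
    exact h.choose_spec

end Chain

/-- Every object over `A` maps to one all of whose outgoing morphisms are split. -/
theorem exists_splitsOut {K : Type w} [MulAction Sᵐᵒᵖ K] {gK : K →[Sᵐᵒᵖ] A}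
    (hK : ∀ N : LocalObj S e A, ∃ ψ : N.carrier →[Sᵐᵒᵖ] K,
      Function.Injective ψ ∧ ∀ n, gK (ψ n) = N.map n)
    {κ : Cardinal.{w}} (hκ : ∀ M : LocalObj S e A, Cardinal.mk M.carrier < κ)
    (X : LocalObj S e A) :
    ∃ M : LocalObj S e A, M.SplitsOut ∧ Nonempty (LocalObj.Hom X M) := by
  by_contra hcon
  have hX : ∀ M : LocalObj S e A, Nonempty (LocalObj.Hom X M) → ¬ M.SplitsOut :=
    fun M h1 h2 => hcon ⟨M, h2, h1⟩
  -- Regularity bounds families of fewer than `μ` indices; uncountability is needed to bound the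
  -- countable iteration of `next`.
  obtain ⟨μ, hμ, hκμ, hreg⟩ : ∃ μ : Cardinal.{w}, Cardinal.aleph0 < μ ∧ κ ≤ μ ∧ μ.IsRegular :=
    ⟨Order.succ (max κ Cardinal.aleph0), Order.lt_succ_of_le (le_max_right _ _),
      (le_max_left _ _).trans (Order.le_succ _), Cardinal.isRegular_succ (le_max_right _ _)⟩
  have hW : ∀ {ι : Type w} (f : ι → μ.ord.ToType), Cardinal.mk ι < μ → ∃ b, ∀ i, f i < b :=
    fun f => exists_strict_bound hreg f
  have : Nonempty μ.ord.ToType := by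
    obtain ⟨b, -⟩ := hW (ι := PEmpty) (fun i => i.elim) (by
      rw [Cardinal.mk_pempty]
      exact hreg.pos)
    exact ⟨b⟩
  have hstep := fun α : μ.ord.ToType => isStep_chain hK hX α
  have hmono : Monotone fun α : μ.ord.ToType => chain X gK α := by
    intro α β hαβ
    rcases hαβ.eq_or_lt with rfl | hlt
    · exact le_rfl
    · exact fun x y hxy => (hstep β).le x y ⟨⟨α, hlt⟩, hxy⟩
  have hsub := fun α : μ.ord.ToType => (hstep α).sub
  obtain ⟨γ, hγ⟩ := exists_inclBijective hμ (fun M => (hκ M).trans_le hκμ) hW hsub hmono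
  exact (hstep γ).not_bij _ (IsSubquotient.iUnion hsub hmono.directed_le)
    (fun x y hxy => ⟨γ, hxy⟩) hγ

end

end MonoidAct

/-! ### Components, coproducts and the cover -/

namespace MonoidAct

section

variable {S : Type u} [Monoid S]

theorem FlatClass.sigma {e : Prop} {ι : Type w} {X : ι → Type w} [∀ i, MulAction Sᵐᵒᵖ (X i)]
    (h : ∀ i, FlatClass e S (X i)) : FlatClass e S (Σ i, X i) := by
  refine ⟨?_, ?_⟩
  · rintro ⟨i, a⟩ ⟨j, a'⟩ t t' heq
    obtain rfl : i = j := congrArg Sigma.fst heq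
    obtain ⟨b, s, s', rfl, rfl, hs⟩ := (h i).1 a a' t t' (sigma_mk_injective heq)
    exact ⟨⟨i, b⟩, s, s', rfl, rfl, hs⟩
  · rintro he ⟨i, a⟩ t t' heq
    obtain ⟨b, s, rfl, hs⟩ := (h i).2 he a t t' (sigma_mk_injective heq)
    exact ⟨⟨i, b⟩, s, rfl, hs⟩

theorem isActIso_of_bijective {X Y : Type w} [MulAction Sᵐᵒᵖ X] [MulAction Sᵐᵒᵖ Y]
    (f : X →[Sᵐᵒᵖ] Y) (hf : Function.Bijective f) : IsActIso f := by
  obtain ⟨k, h1, h2⟩ := Function.bijective_iff_has_inverse.1 hf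
  exact ⟨f.inverse k h1 h2, MulActionHom.ext h1, MulActionHom.ext h2⟩

/-- In an act with condition `(P)`, lying in a common cyclic subact is an equivalence relation;
its classes are the indecomposable components. -/
def componentSetoid {X : Type w} [MulAction Sᵐᵒᵖ X] (hX : ConditionP S X) : Setoid X where
  r x y := ∃ (z : X) (s t : S), x = z <• s ∧ y = z <• t
  iseqv :=
    { refl := fun x => ⟨x, 1, 1, (act_one x).symm, (act_one x).symm⟩
      symm := fun ⟨z, s, t, h, h'⟩ => ⟨z, t, s, h', h⟩
      trans := by
        rintro x y z ⟨a, s, t, rfl, h⟩ ⟨b, s', t', h', rfl⟩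
        obtain ⟨c, k, l, rfl, rfl, -⟩ := hX a b t s' (h.symm.trans h')
        exact ⟨c, k * s, l * t', (act_mul _ _ _).symm, (act_mul _ _ _).symm⟩ }

/-- A component of an act with condition `(P)`. -/
def Component {X : Type w} [MulAction Sᵐᵒᵖ X] (hX : ConditionP S X)
    (c : Quotient (componentSetoid hX)) : Type w :=
  {x : X // Quotient.mk (componentSetoid hX) x = c}

section Component

variable {X : Type w} [MulAction Sᵐᵒᵖ X] {hX : ConditionP S X}

theorem mk_act_eq (x : X) (s : S) : Quotient.mk (componentSetoid hX) (x <• s) =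
    Quotient.mk (componentSetoid hX) x :=
  Quotient.sound ⟨x, s, 1, rfl, (act_one x).symm⟩

variable {c : Quotient (componentSetoid hX)}

instance : MulAction Sᵐᵒᵖ (Component hX c) where
  smul s x := ⟨s • x.1, (mk_act_eq x.1 s.unop).trans x.2⟩
  one_smul x := Subtype.ext (one_smul _ x.1)
  mul_smul s t x := Subtype.ext (mul_smul s t x.1)

theorem Component.mk_mem {z : X} {s : S} (x : Component hX c) (h : x.1 = z <• s) :
    Quotient.mk (componentSetoid hX) z = c := by
  rw [← mk_act_eq z s, ← h, x.2]

/-- The interpolating element generates an element of the component, so it lies in the same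
component. -/
theorem Component.flatClass {e : Prop} (h : FlatClass e S X) :
    FlatClass e S (Component hX c) := by
  refine ⟨fun a a' t t' heq => ?_, fun he a t t' heq => ?_⟩
  · obtain ⟨b, s, s', h1, h2, h3⟩ := h.1 a.1 a'.1 t t' (congrArg Subtype.val heq)
    exact ⟨⟨b, a.mk_mem h1⟩, s, s', Subtype.ext h1, Subtype.ext h2, h3⟩
  · obtain ⟨b, s, h1, h3⟩ := h.2 he a.1 t t' (congrArg Subtype.val heq)
    exact ⟨⟨b, a.mk_mem h1⟩, s, Subtype.ext h1, h3⟩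

theorem Component.locallyCyclic : LocallyCyclic S (Component hX c) := by
  intro x y
  obtain ⟨z, s, t, h1, h2⟩ := Quotient.exact (x.2.trans y.2.symm)
  exact ⟨⟨z, x.mk_mem h1⟩, s, t, Subtype.ext h1, Subtype.ext h2⟩

end Component

section Cover

variable {e : Prop} {A : Type w} [MulAction Sᵐᵒᵖ A]

/-- A component of an act over `A`, as an object over `A`. -/
def componentObj {X : Type w} [MulAction Sᵐᵒᵖ X] (hX : FlatClass e S X) (g : X →[Sᵐᵒᵖ] A)
    (c : Quotient (componentSetoid hX.1)) : LocalObj S e A where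
  carrier := Component hX.1 c
  map := ⟨fun x => g x.1, fun s x => map_smul g s x.1⟩
  nonempty := let ⟨x, hx⟩ := Quotient.exists_rep c; ⟨⟨x, hx⟩⟩
  flat := Component.flatClass hX
  cyclic := Component.locallyCyclic

variable {ι : Type w} (c : ι → LocalObj S e A)

/-- The structure map of a coproduct of objects over `A`. -/
def sigmaMap : (Σ i, (c i).carrier) →[Sᵐᵒᵖ] A where
  toFun x := (c x.1).map x.2
  map_smul' s x := map_smul (c x.1).map s x.2

/-- The inclusion of a summand into a coproduct of objects over `A`. -/
def sigmaIncl (i : ι) : (c i).carrier →[Sᵐᵒᵖ] Σ i, (c i).carrier where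
  toFun x := ⟨i, x⟩
  map_smul' _ _ := rfl

/-- A map from a locally cyclic act into a coproduct factors through a summand. -/
theorem exists_factor_summand (M : LocalObj S e A) (f : M.carrier →[Sᵐᵒᵖ] Σ i, (c i).carrier)
    (hf : ∀ x, sigmaMap c (f x) = M.map x) :
    ∃ (i : ι) (k : LocalObj.Hom M (c i)), ∀ x, f x = ⟨i, k.1 x⟩ := by
  obtain ⟨x₀⟩ := M.nonempty
  have hfst : ∀ (z : M.carrier) (s : S), (f (z <• s)).1 = (f z).1 := fun z s => by
    rw [map_smul]; rfl
  -- The action preserves the summand, and every `x` shares a generator with `x₀`.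
  have h : ∀ x, ∃ y, f x = ⟨(f x₀).1, y⟩ := fun x => by
    obtain ⟨z, s, t, rfl, rfl⟩ := M.cyclic x x₀
    rw [hfst z t, ← hfst z s]
    exact ⟨_, rfl⟩
  choose k hk using h
  refine ⟨_, ⟨⟨k, fun s x => ?_⟩, fun x => ?_⟩, hk⟩
  · refine sigma_mk_injective (β := fun i => (c i).carrier) (i := (f x₀).1) ?_
    change (⟨_, k (s • x)⟩ : Σ i, (c i).carrier) = ⟨_, s • k x⟩
    rw [← hk, map_smul, hk]
    rfl
  · rw [← hf x, hk x]
    rfl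

/-- If the objects over `A` are represented by a family indexed by a small type, and are bounded
in size, then `A` has a cover. -/
theorem hasCover_of_family
    (hc : ∀ N : LocalObj S e A, ∃ i, ∃ f : LocalObj.Hom N (c i), Function.Bijective f.1)
    {κ : Cardinal.{w}} (hκ : ∀ M : LocalObj S e A, Cardinal.mk M.carrier < κ) :
    HasCover (S := S) (fun X _ => FlatClass e S X) A := by
  have hgood : ∀ X : LocalObj S e A, ∃ i, (c i).SplitsOut ∧ Nonempty (LocalObj.Hom X (c i)) := by
    -- The coproduct of the family serves as the act into which every object embeds; splitting is
    -- then transported along an isomorphism to a member of the family.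
    intro X
    obtain ⟨M, hM, ⟨f⟩⟩ := exists_splitsOut (gK := sigmaMap c) (fun N => by
      obtain ⟨i, f, hf⟩ := hc N
      exact ⟨(sigmaIncl c i).comp f.1, sigma_mk_injective.comp hf.1, f.2⟩) hκ X
    obtain ⟨i, k, hk⟩ := hc M
    obtain ⟨k', -, hk'⟩ := LocalObj.Hom.exists_inverse k hk
    refine ⟨i, fun N φ => ?_, ⟨k.comp f⟩⟩
    obtain ⟨r, hr⟩ := hM N (φ.comp k)
    refine ⟨k.comp r, fun x => ?_⟩
    have : r.1 (φ.1 x) = k'.1 x := by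
      rw [← hr (k'.1 x)]
      exact congrArg (fun y => r.1 (φ.1 y)) (hk' x).symm
    exact (congrArg k.1 this).trans (hk' x)
  -- Symmetry holds because a morphism out of a splitting object has a retraction going back.
  let R : Setoid {i : ι // (c i).SplitsOut} :=
    { r := fun i j => Nonempty (LocalObj.Hom (c i.1) (c j.1))
      iseqv := ⟨fun i => ⟨⟨MulActionHom.id _, fun _ => rfl⟩⟩,
        fun {i j} ⟨f⟩ => let ⟨r, _⟩ := i.2 _ f; ⟨r⟩, fun ⟨f⟩ ⟨g⟩ => ⟨g.comp f⟩⟩ }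
  have hout : ∀ q q' : Quotient R, Nonempty (LocalObj.Hom (c q.out.1) (c q'.out.1)) → q = q' :=
    fun q q' h => Quotient.out_equiv_out.1 h
  let d : Quotient R → LocalObj S e A := fun q => c q.out.1
  have hd : ∀ q, (d q).SplitsOut := fun q => q.out.2
  refine ⟨Σ q, (d q).carrier, inferInstance, sigmaMap d,
    ⟨FlatClass.sigma fun q => (d q).flat, ?_⟩, ?_⟩
  · intro P' _ hP' g'
    have hcomp : ∀ C : Quotient (componentSetoid hP'.1),
        ∃ f : (componentObj hP' g' C).carrier →[Sᵐᵒᵖ] Σ q, (d q).carrier,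
          ∀ x, sigmaMap d (f x) = g' x.1 := by
      intro C
      obtain ⟨i, hi, ⟨f⟩⟩ := hgood (componentObj hP' g' C)
      obtain ⟨k⟩ : Nonempty (LocalObj.Hom (c i) (d (Quotient.mk R ⟨i, hi⟩))) :=
        Setoid.symm (Quotient.mk_out (s := R) ⟨i, hi⟩)
      exact ⟨(sigmaIncl d _).comp (k.comp f).1, (k.comp f).2⟩
    choose f hf using hcomp
    have hext : ∀ (x : P') (C) (hx : Quotient.mk (componentSetoid hP'.1) x = C),
        f _ ⟨x, rfl⟩ = f C ⟨x, hx⟩ := by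
      rintro x C rfl
      rfl
    refine ⟨⟨fun x => f (Quotient.mk _ x) ⟨x, rfl⟩, fun s x => ?_⟩,
      MulActionHom.ext fun x => hf _ ⟨x, rfl⟩⟩
    rw [hext (s • x) (Quotient.mk _ x) (mk_act_eq x s.unop)]
    exact map_smul (f (Quotient.mk _ x)) s ⟨x, rfl⟩
  · intro f hf
    -- There is no morphism between different representatives, so `f` preserves each summand, where
    -- it is bijective.
    have hk : ∀ q, ∃ k : LocalObj.Hom (d q) (d q), ∀ x, f ⟨q, x⟩ = ⟨q, k.1 x⟩ := by
      intro q
      obtain ⟨q', k, hk⟩ := exists_factor_summand d (d q) (f.comp (sigmaIncl d q))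
        (fun x => DFunLike.congr_fun hf (⟨q, x⟩ : Σ q, (d q).carrier))
      obtain rfl := hout q q' ⟨k⟩
      exact ⟨k, hk⟩
    choose k hk using hk
    have hkb := fun q => (hd q).bijective (hd q) (k q)
    refine isActIso_of_bijective f ⟨?_, ?_⟩
    · rintro ⟨q, x⟩ ⟨q', x'⟩ h
      rw [hk, hk] at h
      obtain rfl : q = q' := congrArg Sigma.fst h
      rw [(hkb q).1 (sigma_mk_injective (β := fun q => (d q).carrier) h)]
    · rintro ⟨q, y⟩
      obtain ⟨x, rfl⟩ := (hkb q).2 y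
      exact ⟨⟨q, x⟩, hk q x⟩

end Cover

end

/-- Bounded objects over `A` are represented by a small family. -/
theorem exists_family {S : Type u} [Monoid S] {e : Prop} {A : Type (max u v)}
    [MulAction Sᵐᵒᵖ A] {κ : Cardinal.{max u v}}
    (hκ : ∀ M : LocalObj S e A, Cardinal.mk M.carrier < κ) :
    ∃ (ι : Type (max u v)) (c : ι → LocalObj S e A),
      ∀ N : LocalObj S e A, ∃ i, ∃ f : LocalObj.Hom N (c i), Function.Bijective f.1 := by
  -- All act structures over `A` on subsets of one set of size `κ`: a small type containing a copy
  -- of every object.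
  let ι : Type (max u v) := {p : Σ (s : Set κ.out) (_ : MulAction Sᵐᵒᵖ s), s →[Sᵐᵒᵖ] A //
    Nonempty p.1 ∧ (letI := p.2.1; FlatClass e S p.1 ∧ LocallyCyclic S p.1)}
  let c : ι → LocalObj S e A := fun p =>
    letI := p.1.2.1
    ⟨p.1.1, p.1.2.2, p.2.1, p.2.2.1, p.2.2.2⟩
  refine ⟨ι, c, fun N => ?_⟩
  obtain ⟨j⟩ : Nonempty (N.carrier ↪ κ.out) := by
    rw [← Cardinal.le_def, Cardinal.mk_out]
    exact (hκ N).le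
  let E : N.carrier ≃ Set.range j := Equiv.ofInjective j j.injective
  let _ : MulAction Sᵐᵒᵖ (Set.range j) := E.symm.mulAction Sᵐᵒᵖ
  have hE : ∀ (s : Sᵐᵒᵖ) x, E (s • x) = s • E x := fun s x => by
    rw [Equiv.smul_def, Equiv.symm_symm, Equiv.symm_apply_apply]
  have hE' : ∀ (s : Sᵐᵒᵖ) y, E.symm (s • y) = s • E.symm y := fun s y => by
    rw [Equiv.symm_apply_eq, hE, Equiv.apply_symm_apply]
  refine ⟨⟨⟨Set.range j, inferInstance, ⟨fun y => N.map (E.symm y), fun s y => ?_⟩⟩,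
    N.nonempty.map E, ⟨fun a a' t t' h => ?_, fun he a t t' h => ?_⟩, fun a a' => ?_⟩,
    ⟨⟨E, hE⟩, fun x => ?_⟩, E.bijective⟩
  · rw [hE', map_smul]; rfl
  · obtain ⟨b, s, s', h1, h2, h3⟩ := N.flat.1 (E.symm a) (E.symm a') t t' (by
      rw [← hE', ← hE']
      exact congrArg E.symm h)
    exact ⟨E b, s, s', by rw [← hE, ← h1, E.apply_symm_apply],
      by rw [← hE, ← h2, E.apply_symm_apply], h3⟩
  · obtain ⟨b, s, h1, h3⟩ := N.flat.2 he (E.symm a) t t' (by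
      rw [← hE', ← hE']
      exact congrArg E.symm h)
    exact ⟨E b, s, by rw [← hE, ← h1, E.apply_symm_apply], h3⟩
  · obtain ⟨z, s, t, h1, h2⟩ := N.cyclic (E.symm a) (E.symm a')
    exact ⟨E z, s, t, by rw [← hE, ← h1, E.apply_symm_apply],
      by rw [← hE, ← h2, E.apply_symm_apply]⟩
  · exact congrArg N.map (E.symm_apply_apply x)

theorem FlatBounded.hasCover {S : Type u} [Monoid S] {e : Prop}
    (h : FlatBounded.{u, max u v} e S) (A : Type (max u v)) [MulAction Sᵐᵒᵖ A] :
    HasCover (S := S) (fun X _ => FlatClass e S X) A := by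
  obtain ⟨κ, hκ⟩ := h
  have hκ' : ∀ M : LocalObj S e A, Cardinal.mk M.carrier < κ := fun M =>
    hκ M.carrier M.flat M.cyclic
  obtain ⟨ι, c, hc⟩ := exists_family.{u, v} hκ'
  exact hasCover_of_family c hc hκ'

theorem FlatBounded.hasSFCover {S : Type u} [Monoid S]
    (h : FlatBounded.{u, max u v} True S) (A : Type (max u v)) [MulAction Sᵐᵒᵖ A] :
    HasSFCover S A := by
  simpa only [HasSFCover, stronglyFlat_iff] using FlatBounded.hasCover.{u, v} h A

theorem FlatBounded.hasCPCover {S : Type u} [Monoid S]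
    (h : FlatBounded.{u, max u v} False S) (A : Type (max u v)) [MulAction Sᵐᵒᵖ A] :
    HasCPCover S A := by
  simpa only [HasCPCover, conditionP_iff] using FlatBounded.hasCover.{u, v} h A

end MonoidAct

theorem mainTheorem7 :
    -- both classes are closed under submonoids
    (∀ (T : Type u) [Monoid T], MonoidAct.ClassMSF.{u, max u v} T →
      ∀ S : Submonoid T, MonoidAct.ClassMSF.{u, max u v} S) ∧
    (∀ (T : Type u) [Monoid T], MonoidAct.ClassMCP.{u, max u v} T →
      ∀ S : Submonoid T, MonoidAct.ClassMCP.{u, max u v} S) ∧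
    -- covers over the monoids of the two classes
    (∀ (S : Type u) [Monoid S], MonoidAct.ClassMSF.{u, max u v} S →
      ∀ (A : Type (max u v)) [MulAction Sᵐᵒᵖ A], MonoidAct.HasSFCover S A) ∧
    (∀ (S : Type u) [Monoid S], MonoidAct.ClassMCP.{u, max u v} S →
      ∀ (A : Type (max u v)) [MulAction Sᵐᵒᵖ A],
        MonoidAct.HasSFCover S A ∧ MonoidAct.HasCPCover S A) ∧
    -- submonoids of the bicyclic monoid
    (∀ (S : Submonoid MonoidAct.Bicyclic) (A : Type v) [MulAction (↥S)ᵐᵒᵖ A],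
      MonoidAct.HasSFCover S A ∧ MonoidAct.HasCPCover S A) := by
  refine ⟨fun T _ h S => ?_, fun T _ h S => ?_, fun S _ h A _ => ?_, fun S _ h A _ => ?_,
    fun S A _ => ?_⟩
  · exact MonoidAct.classMSF_iff.2 ((MonoidAct.classMSF_iff.1 h).submonoid S)
  · exact MonoidAct.classMCP_iff.2 ((MonoidAct.classMCP_iff.1 h).submonoid S)
  · exact (MonoidAct.classMSF_iff.1 h).hasSFCover A
  · have h' := MonoidAct.classMCP_iff.1 h
    exact ⟨h'.of_false.hasSFCover A, h'.hasCPCover A⟩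
  · have h := fun e => (MonoidAct.Bicyclic.flatBounded.{v} e).submonoid S
    exact ⟨(h True).hasSFCover A, (h False).hasCPCover A⟩
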